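/- Let $\mathbb{K}$ be a field of characteristic zero and $A$ an associative unital $\mathbb{K}$-algebra. Let $\Omega^1(A)=\ker(\mu\colon A\otimes_{\mathbb K} A\to A)$ be the $A$-bimodule of noncommutative Kähler differentials, with universal derivation $da=1\otimes a-a\otimes 1$, let $\Omega^\bullet(A)=T_A(\Omega^1(A))$ be the tensor algebra of this bimodule, with differential $\mathrm d$ (the graded derivation of degree $1$ with $\mathrm d(a)=da$ and $\mathrm d(\sum_i a_i\,db_i)=\sum_i da_i\,db_i$), and let $\mathrm{DR}^\bullet(A)=\Omega^\bullet(A)/[\Omega^\bullet(A),\Omega^\bullet(A)]$ be the Karoubi–de Rham complex, the quotient by the linear span of graded commutators $\alpha\beta-(-1)^{ij}\beta\alpha$ ($\alpha\in\Omega^i(A)$, $\beta\in\Omega^j(A)$), with the induced differential $\mathrm d$. Let $\mathrm{Der}(A)$ be the Lie algebra of $\mathbb K$-linear derivations $A\to A$ with the commutator bracket. For $\theta\in\mathrm{Der}(A)$ let $i_\theta$ be the map on $\mathrm{DR}^\bullet(A)$ induced by the graded derivation of degree $-1$ of $\Omega^\bullet(A)$ that vanishes on $A$ and satisfies $i_\theta(da)=\theta(a)$,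 and put $\mathcal L_\theta=\mathrm d\circ i_\theta+i_\theta\circ\mathrm d$. Let $(A,\omega)$ be an associative symplectic variety: $\omega\in\mathrm{DR}^2(A)$ is closed ($\mathrm d\omega=0$ in $\mathrm{DR}^3(A)$) and nondegenerate, i.e. the map $\omega^\flat\colon\mathrm{Der}(A)\to\mathrm{DR}^1(A)$, $\theta\mapsto i_\theta(\omega)$, is a bijection; denote its inverse by $\omega^\sharp$. For $f\in\mathrm{DR}^0(A)$ put $\theta_f:=-\omega^\sharp(\mathrm df)\in\mathrm{Der}(A)$, for $f,g\in\mathrm{DR}^0(A)$ put $\{f,g\}:=\mathcal L_{\theta_f}(g)\in\mathrm{DR}^0(A)$, and let $\mathrm{Der}^\omega(A)=\{\theta\in\mathrm{Der}(A):\mathcal L_\theta(\omega)=0\}$. Then: 1. The map $A\to\mathrm{DR}^0(A)$ is surjective with kernel the linear span $[A,A]$ of the commutators $ab-ba$, so that $\mathrm{DR}^0(A)=A/[A,A]$. 2. The pair $(\mathrm{DR}^0(A),\{\cdot,\cdot\})$ is a Lie algebra over $\mathbb K$: the bracket is $\mathbb K$-bilinear, satisfies $\{f,f\}=0$ for all $f$,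 and satisfies the Jacobi identity. 3. $\mathrm{Der}^\omega(A)$ is a Lie subalgebra of $\mathrm{Der}(A)$, every $\theta_f$ lies in $\mathrm{Der}^\omega(A)$, and $f\mapsto\theta_f$ is a morphism of Lie algebras $(\mathrm{DR}^0(A),\{\cdot,\cdot\})\to(\mathrm{Der}^\omega(A),[\cdot,\cdot])$: it is $\mathbb K$-linear and $\theta_{\{f,g\}}=[\theta_f,\theta_g]$ for all $f,g\in\mathrm{DR}^0(A)$. -/

import Mathlib

open scoped TensorProduct

set_option linter.unusedSectionVars false

namespace AssocGeom

/-! ### The tensor algebra of a bimodule -/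

section TensorAlgebraOfBimodule

variable (K A M : Type*) [Field K] [Ring A] [Algebra K A] [AddCommGroup M] [Module K M]
  [Module A M] [Module Aᵐᵒᵖ M] [SMulCommClass A Aᵐᵒᵖ M] [IsScalarTower K A M]
  [IsScalarTower K Aᵐᵒᵖ M]

/-- The relations that present the tensor algebra `T_A(M)` of an `A`-bimodule `M` as a quotient of
the free tensor algebra `T_K(A × M)`: products with elements of `A` are computed in `A`, and with
the left and right actions of `A` on `M`. -/
inductive BimodRel : TensorAlgebra K (A × M) → TensorAlgebra K (A × M) → Prop
  | one : BimodRel (TensorAlgebra.ι K ((1, 0) : A × M)) 1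
  | mul (a b : A) : BimodRel (TensorAlgebra.ι K ((a * b, 0) : A × M))
      (TensorAlgebra.ι K ((a, 0) : A × M) * TensorAlgebra.ι K ((b, 0) : A × M))
  | left (a : A) (m : M) : BimodRel (TensorAlgebra.ι K ((0, a • m) : A × M))
      (TensorAlgebra.ι K ((a, 0) : A × M) * TensorAlgebra.ι K ((0, m) : A × M))
  | right (m : M) (a : A) : BimodRel (TensorAlgebra.ι K ((0, MulOpposite.op a • m) : A × M))
      (TensorAlgebra.ι K ((0, m) : A × M) * TensorAlgebra.ι K ((a, 0) : A × M))

/-- The tensor algebra `T_A(M) = A ⊕ M ⊕ (M ⊗_A M) ⊕ ⋯` of an `A`-bimodule `M`, that is, the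
universal `K`-algebra under `A` that receives an `A`-bimodule map from `M`
(see `BimodTensor.lift` and `BimodTensor.algHom_ext`). -/
def BimodTensor : Type _ := RingQuot (BimodRel K A M)

namespace BimodTensor

instance : Ring (BimodTensor K A M) := inferInstanceAs (Ring (RingQuot (BimodRel K A M)))

instance : Algebra K (BimodTensor K A M) :=
  inferInstanceAs (Algebra K (RingQuot (BimodRel K A M)))

/-- The quotient map from the free tensor algebra. -/
def mk : TensorAlgebra K (A × M) →ₐ[K] BimodTensor K A M :=
  RingQuot.mkAlgHom K (BimodRel K A M)

/-- The inclusion of `A` as tensors of degree zero. -/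
def inA : A →ₐ[K] BimodTensor K A M :=
  AlgHom.ofLinearMap ((mk K A M).toLinearMap ∘ₗ TensorAlgebra.ι K ∘ₗ LinearMap.inl K A M)
    (by
      have h := RingQuot.mkAlgHom_rel K (BimodRel.one (K := K) (A := A) (M := M))
      rw [map_one] at h
      exact h)
    (fun a b => by
      have h := RingQuot.mkAlgHom_rel K (BimodRel.mul (K := K) (M := M) a b)
      rw [map_mul] at h
      exact h)

/-- The inclusion of `M` as tensors of degree one. -/
def inM : M →ₗ[K] BimodTensor K A M :=
  (mk K A M).toLinearMap ∘ₗ TensorAlgebra.ι K ∘ₗ LinearMap.inr K A M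

variable {K A M}

theorem inM_smul (a : A) (m : M) : inM K A M (a • m) = inA K A M a * inM K A M m := by
  have h := RingQuot.mkAlgHom_rel K (BimodRel.left (K := K) a m)
  rw [map_mul] at h
  exact h

theorem inM_op_smul (m : M) (a : A) :
    inM K A M (MulOpposite.op a • m) = inM K A M m * inA K A M a := by
  have h := RingQuot.mkAlgHom_rel K (BimodRel.right (K := K) m a)
  rw [map_mul] at h
  exact h

/-- The universal property of `T_A(M)`: an algebra map `A → B` and an `A`-bimodule map `M → B`
extend to an algebra map `T_A(M) → B`. -/
def lift {B : Type*} [Ring B] [Algebra K B] (f : A →ₐ[K] B) (g : M →ₗ[K] B)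
    (hl : ∀ a m, g (a • m) = f a * g m) (hr : ∀ m a, g (MulOpposite.op a • m) = g m * f a) :
    BimodTensor K A M →ₐ[K] B :=
  RingQuot.liftAlgHom K
    ⟨TensorAlgebra.lift K (f.toLinearMap.coprod g), by
      intro x y h
      cases h <;> simp [hl, hr]⟩

section Lift

variable {B : Type*} [Ring B] [Algebra K B] (f : A →ₐ[K] B) (g : M →ₗ[K] B)
    (hl : ∀ a m, g (a • m) = f a * g m) (hr : ∀ m a, g (MulOpposite.op a • m) = g m * f a)

theorem lift_mk (x : TensorAlgebra K (A × M)) :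
    lift f g hl hr (mk K A M x) = TensorAlgebra.lift K (f.toLinearMap.coprod g) x :=
  RingQuot.liftAlgHom_mkAlgHom_apply (S := K) _ _ x

@[simp] theorem lift_inA (a : A) : lift f g hl hr (inA K A M a) = f a := by
  refine (lift_mk f g hl hr (TensorAlgebra.ι K ((a, 0) : A × M))).trans ?_
  simp

@[simp] theorem lift_inM (m : M) : lift f g hl hr (inM K A M m) = g m := by
  refine (lift_mk f g hl hr (TensorAlgebra.ι K ((0, m) : A × M))).trans ?_
  simp

end Lift

/-- `T_A(M)` is generated by `A` and `M`. -/
theorem algHom_ext {B : Type*} [Ring B] [Algebra K B] {f g : BimodTensor K A M →ₐ[K] B}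
    (hA : ∀ a, f (inA K A M a) = g (inA K A M a)) (hM : ∀ m, f (inM K A M m) = g (inM K A M m)) :
    f = g := by
  refine RingQuot.ringQuot_ext' (S := K) (s := BimodRel K A M) f g ?_
  refine TensorAlgebra.hom_ext ?_
  refine LinearMap.ext fun x => ?_
  have hx : x = LinearMap.inl K A M x.1 + LinearMap.inr K A M x.2 := by simp
  rw [hx, map_add, map_add]
  exact congrArg₂ (· + ·) (hA x.1) (hM x.2)

variable (K A M) in
/-- The homogeneous component `T_A^n(M)`, spanned by the products `a m₁ ⋯ mₙ`. -/
def deg (n : ℕ) : Submodule K (BimodTensor K A M) :=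
  LinearMap.range (inA K A M).toLinearMap * LinearMap.range (inM K A M) ^ n

variable (K A M) in
/-- The grading involution: multiplication by `(-1)^n` on the component of degree `n`. -/
def sgn : BimodTensor K A M →ₐ[K] BimodTensor K A M :=
  lift (inA K A M) (-inM K A M) (by simp [inM_smul]) (by simp [inM_op_smul])

@[simp] theorem sgn_inA (a : A) : sgn K A M (inA K A M a) = inA K A M a := by simp [sgn]

@[simp] theorem sgn_inM (m : M) : sgn K A M (inM K A M m) = -inM K A M m := by simp [sgn]

theorem inA_mem (a : A) : inA K A M a ∈ deg K A M 0 := by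
  simp [deg]

theorem inM_mem (m : M) : inM K A M m ∈ deg K A M 1 := by
  rw [deg, pow_one, ← one_mul (inM K A M m), ← map_one (inA K A M)]
  exact Submodule.mul_mem_mul ⟨1, rfl⟩ ⟨m, rfl⟩

theorem deg_zero : deg K A M 0 = LinearMap.range (inA K A M).toLinearMap := by
  simp [deg]

theorem deg_succ (n : ℕ) : deg K A M (n + 1) = deg K A M n * LinearMap.range (inM K A M) := by
  simp [deg, pow_succ, mul_assoc]

theorem range_inA_mul_self : LinearMap.range (inA K A M).toLinearMap *
    LinearMap.range (inA K A M).toLinearMap = LinearMap.range (inA K A M).toLinearMap := by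
  apply le_antisymm
  · rw [Submodule.mul_le]
    rintro _ ⟨a, rfl⟩ _ ⟨b, rfl⟩
    exact ⟨a * b, by simp⟩
  · rintro _ ⟨a, rfl⟩
    have := Submodule.mul_mem_mul (M := LinearMap.range (inA K A M).toLinearMap)
      (N := LinearMap.range (inA K A M).toLinearMap) ⟨a, rfl⟩ ⟨1, rfl⟩
    simpa using this

theorem range_inM_mul_inA : LinearMap.range (inM K A M) *
    LinearMap.range (inA K A M).toLinearMap ≤ LinearMap.range (inM K A M) := by
  rw [Submodule.mul_le]
  rintro _ ⟨m, rfl⟩ _ ⟨b, rfl⟩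
  exact ⟨MulOpposite.op b • m, by simp [inM_op_smul]⟩

theorem deg_mul_inA (n : ℕ) : deg K A M n * LinearMap.range (inA K A M).toLinearMap
    ≤ deg K A M n := by
  cases n with
  | zero => rw [deg_zero, range_inA_mul_self]
  | succ n =>
    rw [deg_succ, mul_assoc]
    exact mul_le_mul' le_rfl range_inM_mul_inA

theorem deg_mul_le (i j : ℕ) : deg K A M i * deg K A M j ≤ deg K A M (i + j) := by
  induction j with
  | zero => rw [deg_zero]; exact deg_mul_inA i
  | succ j ih =>
    rw [deg_succ, ← mul_assoc, ← add_assoc, deg_succ]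
    exact mul_le_mul' ih le_rfl

theorem mul_mem_deg {i j : ℕ} {x y : BimodTensor K A M} (hx : x ∈ deg K A M i)
    (hy : y ∈ deg K A M j) : x * y ∈ deg K A M (i + j) :=
  deg_mul_le i j (Submodule.mul_mem_mul hx hy)

theorem sgn_deg {n : ℕ} {x : BimodTensor K A M} (hx : x ∈ deg K A M n) :
    sgn K A M x = (-1 : K) ^ n • x := by
  induction n generalizing x with
  | zero =>
    rw [deg_zero] at hx
    obtain ⟨a, rfl⟩ := hx
    simp
  | succ n ih =>
    rw [deg_succ] at hx
    refine Submodule.mul_induction_on hx ?_ ?_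
    · rintro x hx _ ⟨m, rfl⟩
      rw [map_mul, ih hx, sgn_inM, pow_succ]
      simp
    · intro x y hx hy
      rw [map_add, hx, hy, smul_add]

/-- The graded Leibniz rule for odd maps, `δ(xy) = δ(x) y + (-1)^{deg x} x δ(y)`. -/
def IsOddDer (δ : BimodTensor K A M →ₗ[K] BimodTensor K A M) : Prop :=
  ∀ x y, δ (x * y) = δ x * y + sgn K A M x * δ y

theorem IsOddDer.ext {δ ε : BimodTensor K A M →ₗ[K] BimodTensor K A M}
    (hδ : IsOddDer δ) (hε : IsOddDer ε)
    (hA : ∀ a, δ (inA K A M a) = ε (inA K A M a)) (hM : ∀ m, δ (inM K A M m) = ε (inM K A M m)) :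
    δ = ε := by
  have key : ∀ ζ : BimodTensor K A M →ₗ[K] BimodTensor K A M, IsOddDer ζ → ζ 1 = 0 := by
    intro ζ h
    have := h 1 1
    simpa using this
  let F : ∀ ζ : BimodTensor K A M →ₗ[K] BimodTensor K A M, IsOddDer ζ →
      BimodTensor K A M →ₐ[K] Matrix (Fin 2) (Fin 2) (BimodTensor K A M) := fun ζ h =>
    AlgHom.ofLinearMap
      { toFun := fun x => !![sgn K A M x, ζ x; 0, x]
        map_add' := fun x y => by
          ext i j; fin_cases i <;> fin_cases j <;> simp
        map_smul' := fun c x => by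
          ext i j; fin_cases i <;> fin_cases j <;> simp }
      (by
        ext i j; fin_cases i <;> fin_cases j <;> simp [key ζ h])
      (fun x y => by
        ext i j; fin_cases i <;> fin_cases j <;>
          simp [Matrix.mul_apply, Fin.sum_univ_two, h x y, add_comm])
  have hF : F δ hδ = F ε hε := by
    refine algHom_ext ?_ ?_
    · intro a; simp [F, hA]
    · intro m; simp [F, hM]
  refine LinearMap.ext fun x => ?_
  have := congrArg (fun Z => Z 0 1) (DFunLike.congr_fun hF x)
  simpa [F] using this

/-- The extension of a derivation `δ₀ : A → T_A(M)` and of a compatible map `δ₁ : M → T_A(M)` to an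
odd derivation of `T_A(M)`; it is read off from the algebra map `x ↦ [±x, δ x; 0, x]`. -/
def oddExt (δ₀ : A →ₗ[K] BimodTensor K A M) (δ₁ : M →ₗ[K] BimodTensor K A M)
    (h0 : ∀ a b, δ₀ (a * b) = δ₀ a * inA K A M b + inA K A M a * δ₀ b)
    (hl : ∀ a m, δ₁ (a • m) = δ₀ a * inM K A M m + inA K A M a * δ₁ m)
    (hr : ∀ m a, δ₁ (MulOpposite.op a • m) = δ₁ m * inA K A M a - inM K A M m * δ₀ a) :
    BimodTensor K A M →ₐ[K] Matrix (Fin 2) (Fin 2) (BimodTensor K A M) :=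
  lift
    (AlgHom.ofLinearMap
      { toFun := fun a => !![inA K A M a, δ₀ a; 0, inA K A M a]
        map_add' := fun x y => by
          ext i j; fin_cases i <;> fin_cases j <;> simp
        map_smul' := fun c x => by
          ext i j; fin_cases i <;> fin_cases j <;> simp }
      (by
        have h1 : δ₀ 1 = 0 := by simpa using h0 1 1
        ext i j; fin_cases i <;> fin_cases j <;> simp [h1])
      (fun x y => by
        ext i j; fin_cases i <;> fin_cases j <;>
          simp [Matrix.mul_apply, Fin.sum_univ_two, h0 x y, add_comm]))
    { toFun := fun m => !![-inM K A M m, δ₁ m; 0, inM K A M m]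
      map_add' := fun x y => by
        ext i j; fin_cases i <;> fin_cases j <;> simp [add_comm]
      map_smul' := fun c x => by
        ext i j; fin_cases i <;> fin_cases j <;> simp }
    (fun a m => by
      ext i j; fin_cases i <;> fin_cases j <;>
        simp [Matrix.mul_apply, Fin.sum_univ_two, inM_smul, hl a m, add_comm])
    (fun m a => by
      ext i j; fin_cases i <;> fin_cases j <;>
        simp [Matrix.mul_apply, Fin.sum_univ_two, inM_op_smul, hr m a]
      abel)

section OddDer

variable (δ₀ : A →ₗ[K] BimodTensor K A M) (δ₁ : M →ₗ[K] BimodTensor K A M)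
    (h0 : ∀ a b, δ₀ (a * b) = δ₀ a * inA K A M b + inA K A M a * δ₀ b)
    (hl : ∀ a m, δ₁ (a • m) = δ₀ a * inM K A M m + inA K A M a * δ₁ m)
    (hr : ∀ m a, δ₁ (MulOpposite.op a • m) = δ₁ m * inA K A M a - inM K A M m * δ₀ a)

theorem oddExt_diag (x : BimodTensor K A M) :
    oddExt δ₀ δ₁ h0 hl hr x 0 0 = sgn K A M x ∧ oddExt δ₀ δ₁ h0 hl hr x 1 0 = 0 ∧
      oddExt δ₀ δ₁ h0 hl hr x 1 1 = x := by
  let F : BimodTensor K A M →ₐ[K] Matrix (Fin 2) (Fin 2) (BimodTensor K A M) :=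
    oddExt δ₀ δ₁ h0 hl hr
  have hlow : ∀ x, F x 1 0 = 0 := by
    let S : Subalgebra K (BimodTensor K A M) :=
      { carrier := {x | F x 1 0 = 0}
        mul_mem' := fun {x y} hx hy => by
          have hx' : F x 1 0 = 0 := hx
          have hy' : F y 1 0 = 0 := hy
          simp [Matrix.mul_apply, Fin.sum_univ_two, hx', hy']
        add_mem' := fun {x y} hx hy => by
          have hx' : F x 1 0 = 0 := hx
          have hy' : F y 1 0 = 0 := hy
          simp [hx', hy']
        algebraMap_mem' := fun c => by
          simp [Matrix.algebraMap_matrix_apply] }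
    have hA : ∀ a, inA K A M a ∈ S := fun a => by
      change F (inA K A M a) 1 0 = 0
      simp [F, oddExt]
    have hM : ∀ m, inM K A M m ∈ S := fun m => by
      change F (inM K A M m) 1 0 = 0
      simp [F, oddExt]
    let p : BimodTensor K A M →ₐ[K] S :=
      lift ((inA K A M).codRestrict S hA) ((inM K A M).codRestrict S.toSubmodule hM)
        (fun a m => Subtype.ext (inM_smul a m)) (fun m a => Subtype.ext (inM_op_smul m a))
    have hp : S.val.comp p = AlgHom.id K _ := by
      refine algHom_ext ?_ ?_
      · intro a; simp [p]
      · intro m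
        simp only [AlgHom.comp_apply, p, lift_inM]
        rfl
    intro x
    have := DFunLike.congr_fun hp x
    have h2 : ((p x : S) : BimodTensor K A M) = x := this
    rw [← h2]
    exact (p x).2
  let G0 : BimodTensor K A M →ₐ[K] BimodTensor K A M := AlgHom.ofLinearMap
    { toFun := fun x => F x 0 0
      map_add' := by simp
      map_smul' := by simp } (by simp)
      (fun x y => by simp [Matrix.mul_apply, Fin.sum_univ_two, hlow])
  let G1 : BimodTensor K A M →ₐ[K] BimodTensor K A M := AlgHom.ofLinearMap
    { toFun := fun x => F x 1 1
      map_add' := by simp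
      map_smul' := by simp } (by simp)
      (fun x y => by simp [Matrix.mul_apply, Fin.sum_univ_two, hlow])
  have e0 : G0 = sgn K A M := by
    refine algHom_ext ?_ ?_
    · intro a; simp [G0, F, oddExt]
    · intro m; simp [G0, F, oddExt]
  have e1 : G1 = AlgHom.id K _ := by
    refine algHom_ext ?_ ?_
    · intro a; simp [G1, F, oddExt]
    · intro m; simp [G1, F, oddExt]
  exact ⟨DFunLike.congr_fun e0 x, hlow x, DFunLike.congr_fun e1 x⟩

/-- The odd derivation of `T_A(M)` that extends `δ₀` and `δ₁`. -/
def oddDer : BimodTensor K A M →ₗ[K] BimodTensor K A M where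
  toFun x := oddExt δ₀ δ₁ h0 hl hr x 0 1
  map_add' := by simp
  map_smul' := by simp

theorem oddDer_isOddDer : IsOddDer (oddDer δ₀ δ₁ h0 hl hr) := by
  intro x y
  have hx := oddExt_diag δ₀ δ₁ h0 hl hr x
  have hy := oddExt_diag δ₀ δ₁ h0 hl hr y
  simp only [oddDer, LinearMap.coe_mk, AddHom.coe_mk, map_mul, Matrix.mul_apply,
    Fin.sum_univ_two, hx.1, hy.2.2]
  rw [add_comm]

@[simp] theorem oddDer_inA (a : A) : oddDer δ₀ δ₁ h0 hl hr (inA K A M a) = δ₀ a := by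
  simp [oddDer, oddExt]

@[simp] theorem oddDer_inM (m : M) : oddDer δ₀ δ₁ h0 hl hr (inM K A M m) = δ₁ m := by
  simp [oddDer, oddExt]

end OddDer

variable (K A M) in
/-- The linear span of the graded commutators `x y - (-1)^{ij} y x`, for `x` of degree `i` and
`y` of degree `j`. -/
def gradedComm : Submodule K (BimodTensor K A M) :=
  Submodule.span K {z | ∃ i j : ℕ, ∃ x ∈ deg K A M i, ∃ y ∈ deg K A M j,
    z = x * y - (-1 : K) ^ (i * j) • (y * x)}

/-- An odd derivation of degree `1` preserves graded commutators. -/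
theorem IsOddDer.gradedComm_le_up {δ : BimodTensor K A M →ₗ[K] BimodTensor K A M}
    (hδ : IsOddDer δ) (hdeg : ∀ n, ∀ x ∈ deg K A M n, δ x ∈ deg K A M (n + 1)) :
    gradedComm K A M ≤ (gradedComm K A M).comap δ := by
  rw [gradedComm, Submodule.span_le]
  rintro _ ⟨i, j, x, hx, y, hy, rfl⟩
  have h1 : δ x * y - (-1 : K) ^ ((i + 1) * j) • (y * δ x) ∈ gradedComm K A M :=
    Submodule.subset_span ⟨i + 1, j, _, hdeg i x hx, y, hy, rfl⟩
  have h2 : x * δ y - (-1 : K) ^ (i * (j + 1)) • (δ y * x) ∈ gradedComm K A M :=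
    Submodule.subset_span ⟨i, j + 1, x, hx, _, hdeg j y hy, rfl⟩
  have h3 := (gradedComm K A M).add_mem h1 ((gradedComm K A M).smul_mem ((-1 : K) ^ i) h2)
  change δ _ ∈ gradedComm K A M
  convert h3 using 1
  have e : (-1 : K) ^ i * (-1) ^ i = 1 := by rw [← mul_pow]; simp
  rw [map_sub, map_smul, hδ, hδ, sgn_deg hx, sgn_deg hy]
  simp only [smul_sub, smul_add, smul_smul, smul_mul_assoc, add_mul, one_mul, mul_add, mul_one,
    pow_add]
  rw [mul_comm ((-1 : K) ^ (i * j)) ((-1) ^ i), ← mul_assoc, e, one_mul]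
  abel

/-- An odd derivation of degree `-1` preserves graded commutators. -/
theorem IsOddDer.gradedComm_le_down {δ : BimodTensor K A M →ₗ[K] BimodTensor K A M}
    (hδ : IsOddDer δ) (hzero : ∀ x ∈ deg K A M 0, δ x = 0)
    (hdeg : ∀ n, ∀ x ∈ deg K A M (n + 1), δ x ∈ deg K A M n) :
    gradedComm K A M ≤ (gradedComm K A M).comap δ := by
  rw [gradedComm, Submodule.span_le]
  rintro _ ⟨i, j, x, hx, y, hy, rfl⟩
  have h1 : δ x * y - ((-1 : K) ^ (i * j) * (-1) ^ j) • (y * δ x) ∈ gradedComm K A M := by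
    cases i with
    | zero => simp [hzero x hx]
    | succ i =>
      refine Submodule.subset_span ⟨i, j, _, hdeg i x hx, y, hy, ?_⟩
      have e : (-1 : K) ^ j * (-1) ^ j = 1 := by rw [← mul_pow]; simp
      rw [add_mul, one_mul, pow_add, mul_assoc, e, mul_one]
  have h2 : x * δ y - ((-1 : K) ^ (i * j) * (-1) ^ i) • (δ y * x) ∈ gradedComm K A M := by
    cases j with
    | zero => simp [hzero y hy]
    | succ j =>
      refine Submodule.subset_span ⟨i, j, x, hx, _, hdeg j y hy, ?_⟩
      have e : (-1 : K) ^ i * (-1) ^ i = 1 := by rw [← mul_pow]; simp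
      rw [mul_add, mul_one, pow_add, mul_assoc, e, mul_one]
  have h3 := (gradedComm K A M).add_mem h1 ((gradedComm K A M).smul_mem ((-1 : K) ^ i) h2)
  change δ _ ∈ gradedComm K A M
  convert h3 using 1
  have e : (-1 : K) ^ i * (-1) ^ i = 1 := by rw [← mul_pow]; simp
  rw [map_sub, map_smul, hδ, hδ, sgn_deg hx, sgn_deg hy]
  simp only [smul_sub, smul_add, smul_smul, smul_mul_assoc]
  rw [mul_comm ((-1 : K) ^ (i * j)) ((-1) ^ i), ← mul_assoc, e, one_mul]
  abel

/-- An odd derivation that raises the degree of generators by one has degree `1`. -/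
theorem IsOddDer.deg_up {δ : BimodTensor K A M →ₗ[K] BimodTensor K A M} (hδ : IsOddDer δ)
    (hA : ∀ a, δ (inA K A M a) ∈ deg K A M 1) (hM : ∀ m, δ (inM K A M m) ∈ deg K A M 2) :
    ∀ n, ∀ x ∈ deg K A M n, δ x ∈ deg K A M (n + 1) := by
  intro n
  induction n with
  | zero =>
    intro x hx
    rw [deg_zero] at hx
    obtain ⟨a, rfl⟩ := hx
    exact hA a
  | succ n ih =>
    intro x hx
    rw [deg_succ] at hx
    refine Submodule.mul_induction_on hx ?_ ?_
    · rintro x hx _ ⟨m, rfl⟩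
      rw [hδ, sgn_deg hx]
      refine Submodule.add_mem _ (mul_mem_deg (ih x hx) (inM_mem m)) ?_
      have h := mul_mem_deg (Submodule.smul_mem (deg K A M n) ((-1 : K) ^ n) hx) (hM m)
      exact h
    · intro x y hx hy
      rw [map_add]
      exact Submodule.add_mem _ hx hy

/-- An odd derivation that vanishes on `A` and maps `M` to `A` has degree `-1`. -/
theorem IsOddDer.deg_down {δ : BimodTensor K A M →ₗ[K] BimodTensor K A M} (hδ : IsOddDer δ)
    (hA : ∀ a, δ (inA K A M a) = 0) (hM : ∀ m, δ (inM K A M m) ∈ deg K A M 0) :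
    ∀ n, ∀ x ∈ deg K A M (n + 1), δ x ∈ deg K A M n := by
  intro n
  induction n with
  | zero =>
    intro x hx
    rw [deg_succ, deg_zero] at hx
    refine Submodule.mul_induction_on hx ?_ ?_
    · rintro _ ⟨a, rfl⟩ _ ⟨m, rfl⟩
      rw [hδ]
      have h := mul_mem_deg (inA_mem (K := K) (M := M) a) (hM m)
      simpa [hA] using h
    · intro x y hx hy
      rw [map_add]
      exact Submodule.add_mem _ hx hy
  | succ n ih =>
    intro x hx
    rw [deg_succ] at hx
    refine Submodule.mul_induction_on hx ?_ ?_
    · rintro x hx _ ⟨m, rfl⟩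
      rw [hδ, sgn_deg hx]
      refine Submodule.add_mem _ (mul_mem_deg (ih x hx) (inM_mem m)) ?_
      have h := mul_mem_deg (Submodule.smul_mem (deg K A M (n + 1)) ((-1 : K) ^ (n + 1)) hx) (hM m)
      exact h
    · intro x y hx hy
      rw [map_add]
      exact Submodule.add_mem _ hx hy

end BimodTensor

end TensorAlgebraOfBimodule

/-! ### Derivations and Kähler differentials -/

section Calculus

variable (K A : Type*) [Field K] [Ring A] [Algebra K A]

/-- The commutator bracket on linear endomorphisms. -/
instance : LieRing (Module.End K A) := LieRing.ofAssociativeRing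

/-- The Lie algebra `Der(A)` of `K`-linear derivations `A → A`, with the commutator bracket. -/
def Der : LieSubalgebra K (Module.End K A) where
  carrier := {θ | ∀ a b, θ (a * b) = θ a * b + a * θ b}
  add_mem' := fun {θ η} hθ hη a b => by
    simp only [LinearMap.add_apply, hθ a b, hη a b, add_mul, mul_add]
    abel
  zero_mem' := fun a b => by simp
  smul_mem' := fun c θ hθ a b => by
    simp only [LinearMap.smul_apply, hθ a b, smul_add, smul_mul_assoc, mul_smul_comm]
  lie_mem' := fun {θ η} hθ hη a b => by
    have hθ' : ∀ a b, θ (a * b) = θ a * b + a * θ b := hθ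
    have hη' : ∀ a b, η (a * b) = η a * b + a * η b := hη
    simp only [Ring.lie_def, LinearMap.sub_apply, Module.End.mul_apply, hθ', hη', map_add,
      sub_mul, mul_sub]
    abel

/-- The noncommutative Kähler differentials `Ω¹(A) = ker (μ : A ⊗ A → A)`. -/
def Omega1 : Type _ := LinearMap.ker (LinearMap.mul' K A)

namespace Omega1

instance : AddCommGroup (Omega1 K A) :=
  inferInstanceAs (AddCommGroup (LinearMap.ker (LinearMap.mul' K A)))

instance : Module K (Omega1 K A) :=
  inferInstanceAs (Module K (LinearMap.ker (LinearMap.mul' K A)))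

/-- The inclusion `Ω¹(A) ⊆ A ⊗ A`. -/
def val : Omega1 K A →ₗ[K] A ⊗[K] A := (LinearMap.ker (LinearMap.mul' K A)).subtype

variable {K A}

theorem val_injective : Function.Injective (val K A) := Subtype.val_injective

theorem mul_val (x : Omega1 K A) : LinearMap.mul' K A (val K A x) = 0 := x.2

/-- An element of the kernel of the multiplication, seen in `Ω¹(A)`. -/
def of (t : A ⊗[K] A) (h : LinearMap.mul' K A t = 0) : Omega1 K A := ⟨t, h⟩

@[simp] theorem val_of (t : A ⊗[K] A) (h : LinearMap.mul' K A t = 0) :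
    val K A (of t h) = t := rfl

theorem mul'_left (a : A) (t : A ⊗[K] A) :
    LinearMap.mul' K A ((a ⊗ₜ 1) * t) = a * LinearMap.mul' K A t := by
  induction t using TensorProduct.induction_on with
  | zero => simp
  | tmul x y => simp [mul_assoc]
  | add x y hx hy => rw [mul_add, map_add, hx, hy, map_add, mul_add]

theorem mul'_right (t : A ⊗[K] A) (a : A) :
    LinearMap.mul' K A (t * (1 ⊗ₜ a)) = LinearMap.mul' K A t * a := by
  induction t using TensorProduct.induction_on with
  | zero => simp
  | tmul x y => simp [mul_assoc]
  | add x y hx hy => rw [add_mul, map_add, hx, hy, map_add, add_mul]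

/-- The left action `a • (a' ⊗ a'') = a a' ⊗ a''`. -/
instance : SMul A (Omega1 K A) :=
  ⟨fun a x => of ((a ⊗ₜ 1) * val K A x) (by rw [mul'_left, mul_val, mul_zero])⟩

/-- The right action `(a' ⊗ a'') • b = a' ⊗ a'' b`. -/
instance : SMul Aᵐᵒᵖ (Omega1 K A) :=
  ⟨fun b x => of (val K A x * (1 ⊗ₜ b.unop)) (by rw [mul'_right, mul_val, zero_mul])⟩

theorem val_smul (a : A) (x : Omega1 K A) : val K A (a • x) = (a ⊗ₜ 1) * val K A x := rfl

theorem val_op_smul (b : Aᵐᵒᵖ) (x : Omega1 K A) :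
    val K A (b • x) = val K A x * (1 ⊗ₜ b.unop) := rfl

instance : Module A (Omega1 K A) where
  one_smul x := val_injective (by rw [val_smul, ← Algebra.TensorProduct.one_def, one_mul])
  mul_smul a b x := val_injective (by simp [val_smul, ← mul_assoc])
  smul_zero a := val_injective (by simp [val_smul])
  zero_smul x := val_injective (by simp [val_smul])
  smul_add a x y := val_injective (by simp [val_smul, mul_add])
  add_smul a b x := val_injective (by simp [val_smul, TensorProduct.add_tmul, add_mul])

instance : Module Aᵐᵒᵖ (Omega1 K A) where
  one_smul x := val_injective (by
    rw [val_op_smul, MulOpposite.unop_one, ← Algebra.TensorProduct.one_def, mul_one])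
  mul_smul a b x := val_injective (by simp [val_op_smul, mul_assoc])
  smul_zero a := val_injective (by simp [val_op_smul])
  zero_smul x := val_injective (by simp [val_op_smul])
  smul_add a x y := val_injective (by simp [val_op_smul, add_mul])
  add_smul a b x := val_injective (by simp [val_op_smul, TensorProduct.tmul_add, mul_add])

instance : SMulCommClass A Aᵐᵒᵖ (Omega1 K A) :=
  ⟨fun a b x => val_injective (by simp [val_smul, val_op_smul, mul_assoc])⟩

instance : IsScalarTower K A (Omega1 K A) :=
  ⟨fun c a x => val_injective (by
    rw [val_smul, map_smul, val_smul, ← TensorProduct.smul_tmul', smul_mul_assoc])⟩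

instance : IsScalarTower K Aᵐᵒᵖ (Omega1 K A) :=
  ⟨fun c a x => val_injective (by
    rw [val_op_smul, map_smul, val_op_smul, MulOpposite.unop_smul, TensorProduct.tmul_smul,
      mul_smul_comm])⟩

variable (K A) in
/-- The universal derivation `a ↦ da = 1 ⊗ a - a ⊗ 1`. -/
def d : A →ₗ[K] Omega1 K A where
  toFun a := of (1 ⊗ₜ a - a ⊗ₜ 1) (by simp)
  map_add' a b := val_injective (by
    simp only [val_of, map_add, TensorProduct.tmul_add, TensorProduct.add_tmul]; abel)
  map_smul' c a := val_injective (by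
    simp only [val_of, map_smul, RingHom.id_apply, TensorProduct.tmul_smul, smul_sub,
      TensorProduct.smul_tmul'])

theorem val_d (a : A) : val K A (d K A a) = 1 ⊗ₜ a - a ⊗ₜ 1 := rfl

theorem d_mul (a b : A) : d K A (a * b) = MulOpposite.op b • d K A a + a • d K A b :=
  val_injective (by simp [val_d, val_smul, val_op_smul, sub_mul, mul_sub])

/-- The bimodule map `i_θ : Ω¹(A) → A` with `i_θ (da) = θ(a)`, that is
`∑ a' ⊗ a'' ↦ ∑ a' θ(a'')`. -/
def contract (θ : Der K A) : Omega1 K A →ₗ[K] A :=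
  LinearMap.mul' K A ∘ₗ LinearMap.lTensor A (θ : Module.End K A) ∘ₗ val K A

theorem Der.map_mul (θ : Der K A) (a b : A) :
    (θ : Module.End K A) (a * b) = (θ : Module.End K A) a * b + a * (θ : Module.End K A) b :=
  θ.2 a b

theorem contract_d (θ : Der K A) (a : A) :
    contract θ (d K A a) = (θ : Module.End K A) a := by
  have h1 : (θ : Module.End K A) 1 = 0 := by simpa using Der.map_mul θ 1 1
  simp [contract, val_d, h1]

theorem contract_smul (θ : Der K A) (a : A) (x : Omega1 K A) :
    contract θ (a • x) = a * contract θ x := by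
  simp only [contract, LinearMap.comp_apply, val_smul]
  induction val K A x using TensorProduct.induction_on with
  | zero => simp
  | tmul x y => simp [mul_assoc]
  | add x y hx hy => rw [mul_add, map_add, map_add, hx, hy, map_add, map_add, mul_add]

theorem contract_op_smul (θ : Der K A) (x : Omega1 K A) (b : A) :
    contract θ (MulOpposite.op b • x) = contract θ x * b := by
  have key : ∀ t : A ⊗[K] A,
      LinearMap.mul' K A (LinearMap.lTensor A (θ : Module.End K A) (t * (1 ⊗ₜ b))) =
        LinearMap.mul' K A (LinearMap.lTensor A (θ : Module.End K A) t) * b +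
          LinearMap.mul' K A t * (θ : Module.End K A) b := by
    intro t
    induction t using TensorProduct.induction_on with
    | zero => simp
    | tmul x y => simp [Der.map_mul, mul_add, mul_assoc]
    | add x y hx hy =>
      rw [add_mul, map_add, map_add, hx, hy, map_add, map_add, map_add, add_mul, add_mul]
      abel
  simp only [contract, LinearMap.comp_apply, val_op_smul, MulOpposite.unop_op]
  rw [key, mul_val, zero_mul, add_zero]

end Omega1

/-! ### The dg-algebra of noncommutative forms -/

/-- The algebra of forms `Ω•(A) = T_A(Ω¹(A))`. -/
abbrev Omega : Type _ := BimodTensor K A (Omega1 K A)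

namespace Omega

open BimodTensor

/-- The map `a' ⊗ a'' ↦ da' da''`, whose restriction to `Ω¹(A)` is `∑ aᵢ dbᵢ ↦ ∑ daᵢ dbᵢ`. -/
def dd : A ⊗[K] A →ₗ[K] Omega K A :=
  TensorProduct.lift ((LinearMap.mul K (Omega K A)).compl₁₂
    (inM K A (Omega1 K A) ∘ₗ Omega1.d K A) (inM K A (Omega1 K A) ∘ₗ Omega1.d K A))

variable {K A}

theorem dd_tmul (a b : A) : dd K A (a ⊗ₜ b) =
    inM K A (Omega1 K A) (Omega1.d K A a) * inM K A (Omega1 K A) (Omega1.d K A b) := by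
  simp [dd]

theorem inM_d_mul (a b : A) : inM K A (Omega1 K A) (Omega1.d K A (a * b)) =
    inM K A (Omega1 K A) (Omega1.d K A a) * inA K A (Omega1 K A) b +
      inA K A (Omega1 K A) a * inM K A (Omega1 K A) (Omega1.d K A b) := by
  rw [Omega1.d_mul, map_add, inM_smul, inM_op_smul]

theorem exists_form (t : A ⊗[K] A) : ∃ y : Omega1 K A,
    Omega1.val K A y = t - LinearMap.mul' K A t ⊗ₜ 1 ∧
    (∀ a, dd K A ((a ⊗ₜ 1) * t) = inM K A (Omega1 K A) (Omega1.d K A a) *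
      inM K A (Omega1 K A) y + inA K A (Omega1 K A) a * dd K A t) ∧
    (∀ a, dd K A (t * (1 ⊗ₜ a)) = dd K A t * inA K A (Omega1 K A) a +
      (inM K A (Omega1 K A) (Omega1.d K A (LinearMap.mul' K A t)) -
        inM K A (Omega1 K A) y) * inM K A (Omega1 K A) (Omega1.d K A a)) := by
  induction t using TensorProduct.induction_on with
  | zero => exact ⟨0, by simp⟩
  | tmul b c =>
    refine ⟨b • Omega1.d K A c, ?_, ?_, ?_⟩
    · simp [Omega1.val_smul, Omega1.val_d, mul_sub]
    · intro a
      simp only [Algebra.TensorProduct.tmul_mul_tmul, one_mul, dd_tmul, inM_d_mul, inM_smul,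
        add_mul, mul_assoc]
    · intro a
      simp only [Algebra.TensorProduct.tmul_mul_tmul, mul_one, dd_tmul, inM_d_mul, inM_smul,
        LinearMap.mul'_apply, mul_add, mul_assoc, add_sub_cancel_right]
  | add s t hs ht =>
    obtain ⟨y, h1, h2, h3⟩ := hs
    obtain ⟨z, k1, k2, k3⟩ := ht
    refine ⟨y + z, ?_, ?_, ?_⟩
    · rw [map_add, h1, k1, map_add, TensorProduct.add_tmul]; abel
    · intro a
      rw [mul_add, map_add, h2, k2, map_add, map_add, mul_add, mul_add]; abel
    · intro a
      rw [add_mul, map_add, h3, k3]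
      simp only [map_add, add_mul, sub_mul]
      abel

theorem dd_smul (a : A) (x : Omega1 K A) : dd K A (Omega1.val K A (a • x)) =
    inM K A (Omega1 K A) (Omega1.d K A a) * inM K A (Omega1 K A) x +
      inA K A (Omega1 K A) a * dd K A (Omega1.val K A x) := by
  obtain ⟨y, h1, h2, -⟩ := exists_form (Omega1.val K A x)
  have hy : y = x := Omega1.val_injective (by rw [h1, Omega1.mul_val]; simp)
  rw [Omega1.val_smul, h2, hy]

theorem dd_op_smul (x : Omega1 K A) (a : A) : dd K A (Omega1.val K A (MulOpposite.op a • x)) =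
    dd K A (Omega1.val K A x) * inA K A (Omega1 K A) a -
      inM K A (Omega1 K A) x * inM K A (Omega1 K A) (Omega1.d K A a) := by
  obtain ⟨y, h1, -, h3⟩ := exists_form (Omega1.val K A x)
  have hy : y = x := Omega1.val_injective (by rw [h1, Omega1.mul_val]; simp)
  rw [Omega1.val_op_smul, MulOpposite.unop_op, h3, hy, Omega1.mul_val]
  simp [sub_eq_add_neg]

theorem dd_mem (t : A ⊗[K] A) : dd K A t ∈ deg K A (Omega1 K A) 2 := by
  induction t using TensorProduct.induction_on with
  | zero => simp
  | tmul a b => rw [dd_tmul]; exact mul_mem_deg (i := 1) (j := 1) (inM_mem _) (inM_mem _)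
  | add s t hs ht => rw [map_add]; exact Submodule.add_mem _ hs ht

variable (K A) in
/-- The differential of `Ω•(A)`: the odd derivation of degree `1` with `a ↦ da` on `A` and
`∑ aᵢ dbᵢ ↦ ∑ daᵢ dbᵢ` on `Ω¹(A)`. -/
def d : Omega K A →ₗ[K] Omega K A :=
  oddDer (inM K A (Omega1 K A) ∘ₗ Omega1.d K A) (dd K A ∘ₗ Omega1.val K A)
    inM_d_mul dd_smul dd_op_smul

/-- The interior product `i_θ` of `Ω•(A)`: the odd derivation of degree `-1` that vanishes on `A`
and satisfies `i_θ(da) = θ(a)`. -/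
def ι (θ : Der K A) : Omega K A →ₗ[K] Omega K A :=
  oddDer 0 ((inA K A (Omega1 K A)).toLinearMap ∘ₗ Omega1.contract θ)
    (by simp) (by simp [Omega1.contract_smul]) (by simp [Omega1.contract_op_smul])

theorem d_isOddDer : IsOddDer (d K A) := oddDer_isOddDer _ _ _ _ _

theorem ι_isOddDer (θ : Der K A) : IsOddDer (ι θ) := oddDer_isOddDer _ _ _ _ _

@[simp] theorem d_inA (a : A) :
    d K A (inA K A (Omega1 K A) a) = inM K A (Omega1 K A) (Omega1.d K A a) := by
  simp [d]

@[simp] theorem d_inM (x : Omega1 K A) :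
    d K A (inM K A (Omega1 K A) x) = dd K A (Omega1.val K A x) := by
  simp [d]

@[simp] theorem ι_inA (θ : Der K A) (a : A) : ι θ (inA K A (Omega1 K A) a) = 0 := by
  simp [ι]

@[simp] theorem ι_inM (θ : Der K A) (x : Omega1 K A) :
    ι θ (inM K A (Omega1 K A) x) = inA K A (Omega1 K A) (Omega1.contract θ x) := by
  simp [ι]

theorem d_deg : ∀ n, ∀ x ∈ deg K A (Omega1 K A) n, d K A x ∈ deg K A (Omega1 K A) (n + 1) :=
  d_isOddDer.deg_up (fun a => by rw [d_inA]; exact inM_mem _)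
    (fun x => by rw [d_inM]; exact dd_mem _)

theorem ι_deg (θ : Der K A) : ∀ n, ∀ x ∈ deg K A (Omega1 K A) (n + 1),
    ι θ x ∈ deg K A (Omega1 K A) n :=
  (ι_isOddDer θ).deg_down (ι_inA θ) (fun x => by rw [ι_inM]; exact inA_mem _)

theorem ι_deg_zero (θ : Der K A) : ∀ x ∈ deg K A (Omega1 K A) 0, ι θ x = 0 := by
  intro x hx
  rw [deg_zero] at hx
  obtain ⟨a, rfl⟩ := hx
  exact ι_inA θ a

theorem ι_add (θ η : Der K A) : ι (θ + η) = ι θ + ι η := by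
  refine (ι_isOddDer _).ext ?_ ?_ ?_
  · intro x y
    simp only [LinearMap.add_apply, ι_isOddDer θ x y, ι_isOddDer η x y, add_mul, mul_add]
    abel
  · intro a; simp
  · intro m
    simp [Omega1.contract, LinearMap.lTensor_add]

theorem ι_smul (c : K) (θ : Der K A) : ι (c • θ) = c • ι θ := by
  refine (ι_isOddDer _).ext ?_ ?_ ?_
  · intro x y
    simp only [LinearMap.smul_apply, ι_isOddDer θ x y, smul_add, smul_mul_assoc, mul_smul_comm]
  · intro a; simp
  · intro m
    simp [Omega1.contract, LinearMap.lTensor_smul]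

end Omega

/-! ### The Karoubi-de Rham complex -/

/-- The Karoubi-de Rham complex `DR•(A) = Ω•(A) / [Ω•(A), Ω•(A)]`, the quotient by the span of
graded commutators. -/
abbrev DR : Type _ := Omega K A ⧸ BimodTensor.gradedComm K A (Omega1 K A)

namespace DR

/-- The class in `DR•(A)` of a form. -/
def mk : Omega K A →ₗ[K] DR K A := (BimodTensor.gradedComm K A (Omega1 K A)).mkQ

/-- The homogeneous component `DRⁿ(A)`. -/
def comp (n : ℕ) : Submodule K (DR K A) := (BimodTensor.deg K A (Omega1 K A) n).map (mk K A)

/-- The class in `DR⁰(A)` of an element of `A`. -/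
def ofA : A →ₗ[K] comp K A 0 :=
  (mk K A ∘ₗ (BimodTensor.inA K A (Omega1 K A)).toLinearMap).codRestrict (comp K A 0)
    (fun a => ⟨_, BimodTensor.inA_mem a, rfl⟩)

/-- The differential of `DR•(A)`. -/
def d : DR K A →ₗ[K] DR K A :=
  Submodule.mapQ _ _ (Omega.d K A) (Omega.d_isOddDer.gradedComm_le_up Omega.d_deg)

variable {K A}

/-- The contraction `i_θ` on `DR•(A)`. -/
def ι (θ : Der K A) : DR K A →ₗ[K] DR K A :=
  Submodule.mapQ _ _ (Omega.ι θ)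
    ((Omega.ι_isOddDer θ).gradedComm_le_down (Omega.ι_deg_zero θ) (Omega.ι_deg θ))

/-- The Lie derivative `L_θ = d ∘ i_θ + i_θ ∘ d` on `DR•(A)`. -/
def lieDer (θ : Der K A) : DR K A →ₗ[K] DR K A := d K A ∘ₗ ι θ + ι θ ∘ₗ d K A

@[simp] theorem d_mk (x : Omega K A) : d K A (mk K A x) = mk K A (Omega.d K A x) := rfl

@[simp] theorem ι_mk (θ : Der K A) (x : Omega K A) : ι θ (mk K A x) = mk K A (Omega.ι θ x) := rfl

theorem d_mem {n : ℕ} {x : DR K A} (hx : x ∈ comp K A n) : d K A x ∈ comp K A (n + 1) := by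
  obtain ⟨y, hy, rfl⟩ := hx
  exact ⟨_, Omega.d_deg n y hy, rfl⟩

theorem ι_mem (θ : Der K A) {n : ℕ} {x : DR K A} (hx : x ∈ comp K A (n + 1)) :
    ι θ x ∈ comp K A n := by
  obtain ⟨y, hy, rfl⟩ := hx
  exact ⟨_, Omega.ι_deg θ n y hy, rfl⟩

theorem ι_zero (θ : Der K A) {x : DR K A} (hx : x ∈ comp K A 0) : ι θ x = 0 := by
  obtain ⟨y, hy, rfl⟩ := hx
  rw [ι_mk, Omega.ι_deg_zero θ y hy, map_zero]

theorem lieDer_mem (θ : Der K A) {n : ℕ} {x : DR K A} (hx : x ∈ comp K A n) :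
    lieDer θ x ∈ comp K A n := by
  cases n with
  | zero =>
    simp only [lieDer, LinearMap.add_apply, LinearMap.comp_apply, ι_zero θ hx, map_zero, zero_add]
    exact ι_mem θ (d_mem hx)
  | succ n => exact Submodule.add_mem _ (d_mem (ι_mem θ hx)) (ι_mem θ (d_mem hx))

theorem ι_add (θ η : Der K A) : (ι (θ + η) : DR K A →ₗ[K] DR K A) = ι θ + ι η := by
  refine LinearMap.ext fun x => ?_
  obtain ⟨y, rfl⟩ := Submodule.Quotient.mk_surjective _ x
  change mk K A (Omega.ι (θ + η) y) = mk K A (Omega.ι θ y) + mk K A (Omega.ι η y)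
  rw [Omega.ι_add, LinearMap.add_apply, map_add]

theorem ι_smul (c : K) (θ : Der K A) : (ι (c • θ) : DR K A →ₗ[K] DR K A) = c • ι θ := by
  refine LinearMap.ext fun x => ?_
  obtain ⟨y, rfl⟩ := Submodule.Quotient.mk_surjective _ x
  change mk K A (Omega.ι (c • θ) y) = c • mk K A (Omega.ι θ y)
  rw [Omega.ι_smul, LinearMap.smul_apply, map_smul]

end DR

/-! ### Associative symplectic varieties -/

variable {K A}

/-- The map `ω♭ : Der(A) → DR¹(A)`, `θ ↦ i_θ(ω)`, of a 2-form `ω ∈ DR²(A)`. -/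
def flat (ω : DR.comp K A 2) : Der K A →ₗ[K] DR.comp K A 1 where
  toFun θ := ⟨DR.ι θ ω, DR.ι_mem θ ω.2⟩
  map_add' θ η := Subtype.ext (by simp [DR.ι_add])
  map_smul' c θ := Subtype.ext (by simp [DR.ι_smul])

/-- `(A, ω)` is an associative symplectic variety: `ω ∈ DR²(A)` is closed and nondegenerate. -/
structure IsSymplectic (ω : DR.comp K A 2) : Prop where
  closed : DR.d K A ω = 0
  nondegenerate : Function.Bijective (flat ω)

/-- The subspace `Der^ω(A)` of symplectic derivations, `L_θ(ω) = 0`. -/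
def symplecticDer (ω : DR.comp K A 2) : Submodule K (Der K A) where
  carrier := {θ | DR.lieDer θ ω = 0}
  add_mem' := fun {θ η} hθ hη => by
    have hθ' : DR.lieDer θ (ω : DR K A) = 0 := hθ
    have hη' : DR.lieDer η (ω : DR K A) = 0 := hη
    have h : DR.lieDer (θ + η) (ω : DR K A) = DR.lieDer θ ω + DR.lieDer η ω := by
      simp only [DR.lieDer, DR.ι_add, LinearMap.add_apply, LinearMap.comp_apply, map_add]
      abel
    simp [h, hθ', hη']
  zero_mem' := by
    have h0 : (DR.ι (0 : Der K A) : DR K A →ₗ[K] DR K A) = 0 := by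
      simpa using DR.ι_smul (0 : K) (0 : Der K A)
    simp [DR.lieDer, h0]
  smul_mem' := fun c θ hθ => by
    have hθ' : DR.lieDer θ (ω : DR K A) = 0 := hθ
    have h : DR.lieDer (c • θ) (ω : DR K A) = c • DR.lieDer θ ω := by
      simp only [DR.lieDer, DR.ι_smul, LinearMap.add_apply, LinearMap.comp_apply,
        LinearMap.smul_apply, map_smul, smul_add]
    simp [h, hθ']

namespace IsSymplectic

variable {ω : DR.comp K A 2} (h : IsSymplectic ω)

/-- The inverse `ω♯ : DR¹(A) → Der(A)` of `ω♭`. -/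
noncomputable def sharp : DR.comp K A 1 →ₗ[K] Der K A :=
  (LinearEquiv.ofBijective (flat ω) h.nondegenerate).symm.toLinearMap

/-- The Hamiltonian derivation `θ_f = -ω♯(df)` of a regular function `f ∈ DR⁰(A)`. -/
noncomputable def hamiltonian (f : DR.comp K A 0) : Der K A :=
  -h.sharp ⟨DR.d K A f, DR.d_mem f.2⟩

/-- The Poisson bracket `{f, g} = L_{θ_f}(g)` on `DR⁰(A)`. -/
noncomputable def poisson (f g : DR.comp K A 0) : DR.comp K A 0 :=
  ⟨DR.lieDer (h.hamiltonian f) g, DR.lieDer_mem _ g.2⟩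

end IsSymplectic

end Calculus

end AssocGeom

/-!
The proof is noncommutative Cartan calculus. On `Ω•(A)` every (graded) derivation is determined by
its values on the elements `a` and `da`, which generate `Ω•(A)` (`Omega.induction`). Comparing
values on these generators gives `d² = 0`, `i_θ² = 0` and `[L_θ, i_η] = i_{[θ,η]}`, where it is used
that the anticommutator of two odd derivations is an even derivation and that the commutator of an
even and an odd derivation is an odd derivation. These identities descend to `DR•(A)`, where they
imply `[L_θ, d] = 0` and `[L_θ, L_η] = L_{[θ,η]}`.

By definition `i_{θ_f} ω = -df`. Hence `L_{θ_f} ω = -d²f + i_{θ_f} dω = 0`, so Hamiltonian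
derivations are symplectic, and `{f, f} = i_{θ_f} df = -i_{θ_f}² ω = 0`. Moreover
`i_{[θ_f, θ_g]} ω = L_{θ_f} i_{θ_g} ω - i_{θ_g} L_{θ_f} ω = -L_{θ_f} dg = -d{f, g}`, which is
`i_{θ_{{f,g}}} ω`, and nondegeneracy gives `θ_{{f,g}} = [θ_f, θ_g]`. Since
`{f, g} = L_{θ_f} g`, the Jacobi identity is then `L_{[θ_f, θ_g]} = [L_{θ_f}, L_{θ_g}]`.

For `DR⁰(A) = A / [A, A]`, the augmentation `T_A(M) → A` that kills `M` maps graded commutators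
into `[A, A]`, because it vanishes in positive degree.
-/

namespace AssocGeom

/-! ### Derivations of the tensor algebra of a bimodule -/

namespace BimodTensor

section

variable {K A M : Type*} [Field K] [Ring A] [Algebra K A] [AddCommGroup M] [Module K M]
  [Module A M] [Module Aᵐᵒᵖ M] [SMulCommClass A Aᵐᵒᵖ M] [IsScalarTower K A M]
  [IsScalarTower K Aᵐᵒᵖ M]

theorem induction {P : BimodTensor K A M → Prop} (hA : ∀ a, P (inA K A M a))
    (hM : ∀ m, P (inM K A M m)) (hadd : ∀ x y, P x → P y → P (x + y))
    (hmul : ∀ x y, P x → P y → P (x * y)) (x : BimodTensor K A M) : P x := by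
  let S : Subalgebra K (BimodTensor K A M) :=
    { carrier := {x | P x}
      mul_mem' := fun {x y} hx hy => hmul x y hx hy
      add_mem' := fun {x y} hx hy => hadd x y hx hy
      algebraMap_mem' := fun c => by
        have h := hA (algebraMap K A c)
        rwa [AlgHom.commutes] at h }
  let p : BimodTensor K A M →ₐ[K] S :=
    lift ((inA K A M).codRestrict S hA) ((inM K A M).codRestrict S.toSubmodule hM)
      (fun a m => Subtype.ext (inM_smul a m)) (fun m a => Subtype.ext (inM_op_smul m a))
  have hp : S.val.comp p = AlgHom.id K _ := by
    refine algHom_ext ?_ ?_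
    · intro a; simp [p]
    · intro m
      simp only [AlgHom.comp_apply, p, lift_inM]
      rfl
  have h2 : ((p x : S) : BimodTensor K A M) = x := DFunLike.congr_fun hp x
  rw [← h2]
  exact (p x).2

theorem sgn_sgn (x : BimodTensor K A M) : sgn K A M (sgn K A M x) = x := by
  induction x using induction with
  | hA a => simp
  | hM m => simp
  | hadd x y hx hy => rw [map_add, map_add, hx, hy]
  | hmul x y hx hy => rw [map_mul, map_mul, hx, hy]

/-- The Leibniz rule `D(xy) = D(x) y + x D(y)`. -/
def IsEvenDer (D : BimodTensor K A M →ₗ[K] BimodTensor K A M) : Prop :=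
  ∀ x y, D (x * y) = D x * y + x * D y

/-- An odd derivation anticommutes with the grading involution as soon as it does so on
generators. -/
theorem IsOddDer.sgn_apply {δ : BimodTensor K A M →ₗ[K] BimodTensor K A M} (hδ : IsOddDer δ)
    (hA : ∀ a, sgn K A M (δ (inA K A M a)) = -δ (inA K A M a))
    (hM : ∀ m, sgn K A M (δ (inM K A M m)) = δ (inM K A M m)) (x : BimodTensor K A M) :
    sgn K A M (δ x) = -δ (sgn K A M x) := by
  induction x using induction with
  | hA a => rw [hA, sgn_inA]
  | hM m => rw [hM, sgn_inM, map_neg, neg_neg]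
  | hadd x y hx hy => rw [map_add, map_add, hx, hy, map_add, map_add, neg_add]
  | hmul x y hx hy =>
    rw [hδ, map_add, map_mul, map_mul, hx, hy, map_mul, hδ]
    noncomm_ring

theorem IsOddDer.anticommutator {δ ε : BimodTensor K A M →ₗ[K] BimodTensor K A M}
    (hδ : IsOddDer δ) (hε : IsOddDer ε) (sδ : ∀ x, sgn K A M (δ x) = -δ (sgn K A M x))
    (sε : ∀ x, sgn K A M (ε x) = -ε (sgn K A M x)) : IsEvenDer (δ ∘ₗ ε + ε ∘ₗ δ) := by
  intro x y
  simp only [LinearMap.add_apply, LinearMap.comp_apply, hδ x y, hε x y, map_add, hδ (ε x) y,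
    hδ (sgn K A M x), hε (δ x) y, hε (sgn K A M x), sδ, sε, sgn_sgn]
  noncomm_ring

theorem IsEvenDer.commutator {D δ : BimodTensor K A M →ₗ[K] BimodTensor K A M}
    (hD : IsEvenDer D) (hδ : IsOddDer δ) (sD : ∀ x, sgn K A M (D x) = D (sgn K A M x)) :
    IsOddDer (D ∘ₗ δ - δ ∘ₗ D) := by
  intro x y
  simp only [LinearMap.sub_apply, LinearMap.comp_apply, hδ x y, hD x y, map_add,
    hD (δ x) y, hD (sgn K A M x), hδ (D x) y, hδ x (D y), sD]
  noncomm_ring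

variable (K A M) in
/-- The augmentation `T_A(M) → A`, the identity on `A` and zero on `M`. -/
def aug : BimodTensor K A M →ₐ[K] A :=
  lift (AlgHom.id K A) 0 (by simp) (by simp)

@[simp] theorem aug_inA (a : A) : aug K A M (inA K A M a) = a := by simp [aug]

@[simp] theorem aug_inM (m : M) : aug K A M (inM K A M m) = 0 := by simp [aug]

theorem aug_deg_succ {n : ℕ} {x : BimodTensor K A M} (hx : x ∈ deg K A M (n + 1)) :
    aug K A M x = 0 := by
  rw [deg_succ] at hx
  refine Submodule.mul_induction_on hx ?_ ?_
  · rintro x - _ ⟨m, rfl⟩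
    rw [map_mul, aug_inM, mul_zero]
  · intro x y hx hy
    rw [map_add, hx, hy, add_zero]

theorem aug_gradedComm {x : BimodTensor K A M} (hx : x ∈ gradedComm K A M) :
    aug K A M x ∈ Submodule.span K {c : A | ∃ a b : A, c = a * b - b * a} := by
  suffices h : gradedComm K A M ≤ (Submodule.span K {c : A | ∃ a b : A, c = a * b - b * a}).comap
      (aug K A M).toLinearMap from h hx
  rw [gradedComm, Submodule.span_le]
  rintro _ ⟨i, j, x, hx, y, hy, rfl⟩
  change aug K A M _ ∈ Submodule.span K {c : A | ∃ a b : A, c = a * b - b * a}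
  rw [map_sub, map_smul, map_mul, map_mul]
  rcases i with _ | i
  · rcases j with _ | j
    · exact Submodule.subset_span ⟨aug K A M x, aug K A M y, by simp⟩
    · simp [aug_deg_succ hy]
  · simp [aug_deg_succ hx]

/-- In degree zero the graded commutators are the commutators of `A`. -/
theorem inA_mem_gradedComm_iff {a : A} : inA K A M a ∈ gradedComm K A M ↔
    a ∈ Submodule.span K {c : A | ∃ a b : A, c = a * b - b * a} := by
  constructor
  · intro h
    simpa using aug_gradedComm h
  · intro h
    suffices hle : Submodule.span K {c : A | ∃ a b : A, c = a * b - b * a} ≤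
        (gradedComm K A M).comap (inA K A M).toLinearMap from hle h
    rw [Submodule.span_le]
    rintro _ ⟨a, b, rfl⟩
    exact Submodule.subset_span ⟨0, 0, _, inA_mem a, _, inA_mem b, by simp⟩

end

end BimodTensor

section Cartan

variable {K A : Type*} [Field K] [Ring A] [Algebra K A]

/-! ### Cartan calculus on noncommutative forms -/

/-- `Ω¹(A)` is spanned by the forms `a db`. -/
theorem Omega1.induction {P : Omega1 K A → Prop} (hd : ∀ a b : A, P (a • Omega1.d K A b))
    (hadd : ∀ x y, P x → P y → P (x + y)) (x : Omega1 K A) : P x := by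
  -- The projection `a ⊗ b ↦ a ⊗ b - ab ⊗ 1` of `A ⊗ A` onto `Ω¹(A)` has the values `a db`.
  have key : ∀ t : A ⊗[K] A, ∃ y : Omega1 K A,
      Omega1.val K A y = t - LinearMap.mul' K A t ⊗ₜ 1 ∧ P y := by
    intro t
    induction t using TensorProduct.induction_on with
    | zero => exact ⟨0, by simp, by simpa using hd 0 0⟩
    | tmul b c => exact ⟨b • Omega1.d K A c, by simp [val_smul, val_d, mul_sub], hd b c⟩
    | add s t hs ht =>
      obtain ⟨y, hy, hPy⟩ := hs
      obtain ⟨z, hz, hPz⟩ := ht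
      refine ⟨y + z, ?_, hadd y z hPy hPz⟩
      rw [map_add, hy, hz, map_add, TensorProduct.add_tmul]
      abel
  obtain ⟨y, hy, hPy⟩ := key (Omega1.val K A x)
  have hyx : y = x := Omega1.val_injective (by rw [hy, Omega1.mul_val]; simp)
  exact hyx ▸ hPy

namespace Omega

open BimodTensor

theorem induction {P : Omega K A → Prop} (hA : ∀ a, P (inA K A (Omega1 K A) a))
    (hd : ∀ a, P (inM K A (Omega1 K A) (Omega1.d K A a))) (hadd : ∀ x y, P x → P y → P (x + y))
    (hmul : ∀ x y, P x → P y → P (x * y)) (x : Omega K A) : P x := by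
  refine BimodTensor.induction hA ?_ hadd hmul x
  intro m
  induction m using Omega1.induction with
  | hd a b => rw [inM_smul]; exact hmul _ _ (hA a) (hd b)
  | hadd x y hx hy => rw [map_add]; exact hadd _ _ hx hy

theorem oddDer_ext {δ ε : Omega K A →ₗ[K] Omega K A} (hδ : IsOddDer δ) (hε : IsOddDer ε)
    (hA : ∀ a, δ (inA K A (Omega1 K A) a) = ε (inA K A (Omega1 K A) a))
    (hd : ∀ a, δ (inM K A (Omega1 K A) (Omega1.d K A a)) =
      ε (inM K A (Omega1 K A) (Omega1.d K A a))) : δ = ε := by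
  refine LinearMap.ext fun x => ?_
  induction x using induction with
  | hA a => exact hA a
  | hd a => exact hd a
  | hadd x y hx hy => rw [map_add, map_add, hx, hy]
  | hmul x y hx hy => rw [hδ, hε, hx, hy]

theorem evenDer_eq_zero {D : Omega K A →ₗ[K] Omega K A} (hD : IsEvenDer D)
    (hA : ∀ a, D (inA K A (Omega1 K A) a) = 0)
    (hd : ∀ a, D (inM K A (Omega1 K A) (Omega1.d K A a)) = 0) : D = 0 := by
  refine LinearMap.ext fun x => ?_
  change D x = 0
  induction x using induction with
  | hA a => exact hA a
  | hd a => exact hd a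
  | hadd x y hx hy => rw [map_add, hx, hy, add_zero]
  | hmul x y hx hy => rw [hD, hx, hy, zero_mul, mul_zero, add_zero]

theorem sgn_d (x : Omega K A) :
    sgn K A (Omega1 K A) (d K A x) = -d K A (sgn K A (Omega1 K A) x) := by
  refine d_isOddDer.sgn_apply (fun a => ?_) (fun m => ?_) x
  · rw [d_inA, sgn_inM]
  · rw [d_inM, sgn_deg (dd_mem _)]
    simp

theorem sgn_ι (θ : Der K A) (x : Omega K A) :
    sgn K A (Omega1 K A) (ι θ x) = -ι θ (sgn K A (Omega1 K A) x) := by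
  refine (ι_isOddDer θ).sgn_apply (fun a => ?_) (fun m => ?_) x
  · simp
  · rw [ι_inM, sgn_inA]

theorem d_inM_d (a : A) : d K A (inM K A (Omega1 K A) (Omega1.d K A a)) = 0 := by
  have h1 : Omega1.d K A 1 = 0 := by simpa using Omega1.d_mul (K := K) (1 : A) 1
  rw [d_inM, Omega1.val_d, map_sub, dd_tmul, dd_tmul, h1]
  simp

theorem ι_inM_d (θ : Der K A) (a : A) : ι θ (inM K A (Omega1 K A) (Omega1.d K A a)) =
    inA K A (Omega1 K A) ((θ : Module.End K A) a) := by
  rw [ι_inM, Omega1.contract_d]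

/-- The square of an odd derivation `δ` is half the anticommutator of `δ` with itself, and thus
vanishes if it vanishes on generators. -/
theorem sq_eq_zero [CharZero K] {δ : Omega K A →ₗ[K] Omega K A} (hδ : IsOddDer δ)
    (sδ : ∀ x, sgn K A (Omega1 K A) (δ x) = -δ (sgn K A (Omega1 K A) x))
    (hA : ∀ a, δ (δ (inA K A (Omega1 K A) a)) = 0)
    (hd : ∀ a, δ (δ (inM K A (Omega1 K A) (Omega1.d K A a))) = 0) (x : Omega K A) :
    δ (δ x) = 0 := by
  have h := evenDer_eq_zero (hδ.anticommutator hδ sδ sδ) (by simp [hA]) (by simp [hd])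
  have hx : δ (δ x) + δ (δ x) = 0 := DFunLike.congr_fun h x
  have h2 : (2 : K) • δ (δ x) = 0 := by rw [two_smul, hx]
  exact (smul_eq_zero.mp h2).resolve_left two_ne_zero

theorem d_d [CharZero K] (x : Omega K A) : d K A (d K A x) = 0 :=
  sq_eq_zero d_isOddDer sgn_d (by simp [-d_inM, d_inM_d]) (by simp [-d_inM, d_inM_d]) x

theorem ι_ι_self [CharZero K] (θ : Der K A) (x : Omega K A) : ι θ (ι θ x) = 0 :=
  sq_eq_zero (ι_isOddDer θ) (sgn_ι θ) (by simp) (by simp) x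

/-- The Lie derivative `L_θ = d ∘ i_θ + i_θ ∘ d` on `Ω•(A)`. -/
def lieDer (θ : Der K A) : Omega K A →ₗ[K] Omega K A := d K A ∘ₗ ι θ + ι θ ∘ₗ d K A

theorem lieDer_isEvenDer (θ : Der K A) : IsEvenDer (lieDer θ) :=
  d_isOddDer.anticommutator (ι_isOddDer θ) sgn_d (sgn_ι θ)

theorem sgn_lieDer (θ : Der K A) (x : Omega K A) :
    sgn K A (Omega1 K A) (lieDer θ x) = lieDer θ (sgn K A (Omega1 K A) x) := by
  simp only [lieDer, LinearMap.add_apply, LinearMap.comp_apply, map_add, sgn_d, sgn_ι, map_neg,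
    neg_neg]

theorem lieDer_inA (θ : Der K A) (a : A) : lieDer θ (inA K A (Omega1 K A) a) =
    inA K A (Omega1 K A) ((θ : Module.End K A) a) := by
  simp only [lieDer, LinearMap.add_apply, LinearMap.comp_apply, ι_inA, map_zero, zero_add, d_inA,
    ι_inM_d]

theorem lieDer_inM_d (θ : Der K A) (a : A) :
    lieDer θ (inM K A (Omega1 K A) (Omega1.d K A a)) =
      inM K A (Omega1 K A) (Omega1.d K A ((θ : Module.End K A) a)) := by
  simp only [lieDer, LinearMap.add_apply, LinearMap.comp_apply, ι_inM_d, d_inM_d, d_inA, map_zero,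
    add_zero]

/-- The Cartan identity `[L_θ, i_η] = i_{[θ,η]}` on `Ω•(A)`. -/
theorem lieDer_comp_ι_sub (θ η : Der K A) :
    lieDer θ ∘ₗ ι η - ι η ∘ₗ lieDer θ = ι ⁅θ, η⁆ := by
  refine oddDer_ext ((lieDer_isEvenDer θ).commutator (ι_isOddDer η) (sgn_lieDer θ))
    (ι_isOddDer _) (fun a => ?_) (fun a => ?_)
  · simp only [LinearMap.sub_apply, LinearMap.comp_apply, lieDer_inA, ι_inA, map_zero, sub_zero]
  · simp only [LinearMap.sub_apply, LinearMap.comp_apply, lieDer_inA, lieDer_inM_d, ι_inM_d]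
    rw [← map_sub]
    rfl

end Omega

/-! ### Cartan calculus on the Karoubi-de Rham complex -/

namespace DR

theorem mk_surjective : Function.Surjective (mk K A) :=
  Submodule.Quotient.mk_surjective _

theorem d_d [CharZero K] (x : DR K A) : d K A (d K A x) = 0 := by
  obtain ⟨y, rfl⟩ := mk_surjective x
  rw [d_mk, d_mk, Omega.d_d, map_zero]

theorem ι_ι_self [CharZero K] (θ : Der K A) (x : DR K A) : ι θ (ι θ x) = 0 := by
  obtain ⟨y, rfl⟩ := mk_surjective x
  rw [ι_mk, ι_mk, Omega.ι_ι_self, map_zero]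

theorem lieDer_apply (θ : Der K A) (x : DR K A) :
    lieDer θ x = d K A (ι θ x) + ι θ (d K A x) := rfl

theorem lieDer_mk (θ : Der K A) (x : Omega K A) :
    lieDer θ (mk K A x) = mk K A (Omega.lieDer θ x) := by
  rw [lieDer_apply, ι_mk, d_mk, d_mk, ι_mk, ← map_add]
  rfl

theorem lieDer_of_comp_zero (θ : Der K A) {x : DR K A} (hx : x ∈ comp K A 0) :
    lieDer θ x = ι θ (d K A x) := by
  rw [lieDer_apply, ι_zero θ hx, map_zero, zero_add]

theorem lieDer_add (θ η : Der K A) :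
    (lieDer (θ + η) : DR K A →ₗ[K] DR K A) = lieDer θ + lieDer η := by
  refine LinearMap.ext fun x => ?_
  simp only [lieDer_apply, ι_add, LinearMap.add_apply, map_add]
  abel

theorem lieDer_smul (c : K) (θ : Der K A) :
    (lieDer (c • θ) : DR K A →ₗ[K] DR K A) = c • lieDer θ := by
  refine LinearMap.ext fun x => ?_
  simp only [lieDer_apply, ι_smul, LinearMap.smul_apply, map_smul, smul_add]

/-- The Cartan identity `[L_θ, i_η] = i_{[θ,η]}` on `DR•(A)`. -/
theorem lieDer_ι (θ η : Der K A) (x : DR K A) :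
    lieDer θ (ι η x) = ι ⁅θ, η⁆ x + ι η (lieDer θ x) := by
  obtain ⟨y, rfl⟩ := mk_surjective x
  rw [ι_mk, ι_mk, lieDer_mk, lieDer_mk, ι_mk, ← Omega.lieDer_comp_ι_sub, ← map_add]
  simp

theorem lieDer_d [CharZero K] (θ : Der K A) (x : DR K A) :
    lieDer θ (d K A x) = d K A (lieDer θ x) := by
  rw [lieDer_apply, lieDer_apply, map_add, d_d, d_d, map_zero, zero_add, add_zero]

/-- The Cartan identity `[L_θ, L_η] = L_{[θ,η]}` on `DR•(A)`. -/
theorem lieDer_lieDer [CharZero K] (θ η : Der K A) (x : DR K A) :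
    lieDer θ (lieDer η x) = lieDer ⁅θ, η⁆ x + lieDer η (lieDer θ x) := by
  rw [lieDer_apply η, map_add, lieDer_d, lieDer_ι, lieDer_ι, lieDer_apply ⁅θ, η⁆,
    lieDer_apply η (lieDer θ x), lieDer_d, map_add]
  abel

theorem ofA_surjective : Function.Surjective (ofA K A) := by
  rintro ⟨_, y, hy, rfl⟩
  have hy' : y ∈ BimodTensor.deg K A (Omega1 K A) 0 := hy
  rw [BimodTensor.deg_zero] at hy'
  obtain ⟨a, rfl⟩ := hy'
  exact ⟨a, rfl⟩

theorem ker_ofA : LinearMap.ker (ofA K A) =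
    Submodule.span K {c : A | ∃ a b : A, c = a * b - b * a} := by
  ext a
  rw [LinearMap.mem_ker, ← BimodTensor.inA_mem_gradedComm_iff (M := Omega1 K A), Subtype.ext_iff]
  exact Submodule.Quotient.mk_eq_zero _

end DR

/-! ### The Poisson bracket of an associative symplectic variety -/

theorem mem_symplecticDer {ω : DR.comp K A 2} {θ : Der K A} :
    θ ∈ symplecticDer ω ↔ DR.lieDer θ (ω : DR K A) = 0 := Iff.rfl

/-- The Lie subalgebra `Der^ω(A)` of `Der(A)`. -/
def symplecticLie [CharZero K] (ω : DR.comp K A 2) : LieSubalgebra K (Der K A) where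
  toSubmodule := symplecticDer ω
  lie_mem' := fun {θ η} hθ hη => by
    have hθ' : DR.lieDer θ (ω : DR K A) = 0 := hθ
    have hη' : DR.lieDer η (ω : DR K A) = 0 := hη
    have h := DR.lieDer_lieDer θ η (ω : DR K A)
    rw [hθ', hη', map_zero, map_zero, add_zero] at h
    exact h.symm

namespace IsSymplectic

variable {ω : DR.comp K A 2} (h : IsSymplectic ω)

theorem hamiltonian_add (f g : DR.comp K A 0) :
    h.hamiltonian (f + g) = h.hamiltonian f + h.hamiltonian g := by
  rw [hamiltonian, hamiltonian, hamiltonian, ← neg_add, ← map_add]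
  congr 2
  exact Subtype.ext (map_add (DR.d K A) (f : DR K A) g)

theorem hamiltonian_smul (c : K) (f : DR.comp K A 0) :
    h.hamiltonian (c • f) = c • h.hamiltonian f := by
  rw [hamiltonian, hamiltonian, smul_neg, ← map_smul]
  congr 2
  exact Subtype.ext (map_smul (DR.d K A) c (f : DR K A))

/-- The defining equation `i_{θ_f} ω = -df` of the Hamiltonian derivation. -/
theorem ι_hamiltonian (f : DR.comp K A 0) :
    DR.ι (h.hamiltonian f) (ω : DR K A) = -DR.d K A f := by
  have h1 : flat ω (h.hamiltonian f) = -⟨DR.d K A f, DR.d_mem f.2⟩ := by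
    rw [hamiltonian, map_neg]
    congr 1
    exact (LinearEquiv.ofBijective (flat ω) h.nondegenerate).apply_symm_apply _
  exact congrArg Subtype.val h1

theorem ι_injective (h : IsSymplectic ω) {θ η : Der K A} (e : DR.ι θ (ω : DR K A) = DR.ι η ω) : θ = η :=
  h.nondegenerate.1 (Subtype.ext e)

theorem hamiltonian_mem [CharZero K] (f : DR.comp K A 0) :
    h.hamiltonian f ∈ symplecticDer ω := by
  rw [mem_symplecticDer, DR.lieDer_apply, h.closed, h.ι_hamiltonian, map_neg, DR.d_d, map_zero,
    neg_zero, add_zero]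

theorem coe_poisson (f g : DR.comp K A 0) :
    (h.poisson f g : DR K A) = DR.lieDer (h.hamiltonian f) g := rfl

theorem hamiltonian_poisson [CharZero K] (f g : DR.comp K A 0) :
    h.hamiltonian (h.poisson f g) = ⁅h.hamiltonian f, h.hamiltonian g⁆ := by
  refine h.ι_injective ?_
  have e := DR.lieDer_ι (h.hamiltonian f) (h.hamiltonian g) (ω : DR K A)
  rw [mem_symplecticDer.mp (h.hamiltonian_mem f), map_zero, add_zero, h.ι_hamiltonian, map_neg,
    DR.lieDer_d] at e
  rw [h.ι_hamiltonian, coe_poisson, e]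

/-- The Poisson bracket as a bilinear map. -/
noncomputable def poissonBilin : DR.comp K A 0 →ₗ[K] DR.comp K A 0 →ₗ[K] DR.comp K A 0 :=
  LinearMap.mk₂ K h.poisson
    (fun f f' g => Subtype.ext (by
      simp only [coe_poisson, hamiltonian_add, DR.lieDer_add, LinearMap.add_apply,
        Submodule.coe_add]))
    (fun c f g => Subtype.ext (by
      simp only [coe_poisson, hamiltonian_smul, DR.lieDer_smul, LinearMap.smul_apply,
        Submodule.coe_smul]))
    (fun f g g' => Subtype.ext (by simp only [coe_poisson, Submodule.coe_add, map_add]))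
    (fun c f g => Subtype.ext (by simp only [coe_poisson, Submodule.coe_smul, map_smul]))

theorem poisson_self [CharZero K] (f : DR.comp K A 0) : h.poisson f f = 0 := by
  have hd : DR.d K A f = -DR.ι (h.hamiltonian f) (ω : DR K A) := by
    rw [h.ι_hamiltonian, neg_neg]
  refine Subtype.ext ?_
  rw [coe_poisson, DR.lieDer_of_comp_zero _ f.2, hd, map_neg, DR.ι_ι_self, neg_zero]
  rfl

theorem poisson_antisymm [CharZero K] (f g : DR.comp K A 0) :
    h.poisson f g = -h.poisson g f := by
  have hB : h.poissonBilin.IsAlt := h.poisson_self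
  exact (hB.neg g f).symm

/-- The Jacobi identity in the form of a Leibniz rule for `{f, ·}`. -/
theorem poisson_poisson [CharZero K] (f₁ f₂ f₃ : DR.comp K A 0) :
    h.poisson f₁ (h.poisson f₂ f₃) =
      h.poisson (h.poisson f₁ f₂) f₃ + h.poisson f₂ (h.poisson f₁ f₃) := by
  refine Subtype.ext ?_
  rw [Submodule.coe_add]
  simp only [coe_poisson, hamiltonian_poisson]
  exact DR.lieDer_lieDer _ _ _

theorem poisson_neg_right (f g : DR.comp K A 0) : h.poisson f (-g) = -h.poisson f g :=
  map_neg (h.poissonBilin f) g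

theorem poisson_jacobi [CharZero K] (f₁ f₂ f₃ : DR.comp K A 0) :
    h.poisson f₁ (h.poisson f₂ f₃) + h.poisson f₂ (h.poisson f₃ f₁) +
      h.poisson f₃ (h.poisson f₁ f₂) = 0 := by
  rw [h.poisson_poisson f₁ f₂ f₃, h.poisson_antisymm f₃ f₁, poisson_neg_right,
    h.poisson_antisymm f₃ (h.poisson f₁ f₂)]
  abel

/-- The morphism `f ↦ θ_f` from `DR⁰(A)` to `Der^ω(A)`. -/
noncomputable def hamiltonianMap [CharZero K] : DR.comp K A 0 →ₗ[K] symplecticLie ω where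
  toFun f := ⟨h.hamiltonian f, h.hamiltonian_mem f⟩
  map_add' f g := Subtype.ext (h.hamiltonian_add f g)
  map_smul' c f := Subtype.ext (h.hamiltonian_smul c f)

end IsSymplectic

end Cartan

end AssocGeom

theorem mainTheorem3 {K A : Type*} [Field K] [CharZero K] [Ring A] [Algebra K A]
    (ω : AssocGeom.DR.comp K A 2) (h : AssocGeom.IsSymplectic ω) :
    -- `DR⁰(A) = A / [A, A]`
    (Function.Surjective (AssocGeom.DR.ofA K A) ∧
      LinearMap.ker (AssocGeom.DR.ofA K A) =
        Submodule.span K {c : A | ∃ a b : A, c = a * b - b * a}) ∧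
    -- the Poisson bracket is bilinear, alternating, and satisfies the Jacobi identity
    ((∃ B : AssocGeom.DR.comp K A 0 →ₗ[K] AssocGeom.DR.comp K A 0 →ₗ[K] AssocGeom.DR.comp K A 0,
        ∀ f g, B f g = h.poisson f g) ∧
      (∀ f, h.poisson f f = 0) ∧
      (∀ f₁ f₂ f₃, h.poisson f₁ (h.poisson f₂ f₃) + h.poisson f₂ (h.poisson f₃ f₁) +
        h.poisson f₃ (h.poisson f₁ f₂) = 0)) ∧
    -- `Der^ω(A)` is a Lie subalgebra of `Der(A)`, and `f ↦ θ_f` is a Lie algebra morphism to it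
    (∃ 𝔤 : LieSubalgebra K (AssocGeom.Der K A), 𝔤.toSubmodule = AssocGeom.symplecticDer ω ∧
      ∃ Θ : AssocGeom.DR.comp K A 0 →ₗ[K] 𝔤,
        (∀ f, (Θ f : AssocGeom.Der K A) = h.hamiltonian f) ∧
        (∀ f g, Θ (h.poisson f g) = ⁅Θ f, Θ g⁆)) := by
  refine ⟨⟨AssocGeom.DR.ofA_surjective, AssocGeom.DR.ker_ofA⟩,
    ⟨⟨h.poissonBilin, fun _ _ => rfl⟩, h.poisson_self, h.poisson_jacobi⟩,
    AssocGeom.symplecticLie ω, rfl, h.hamiltonianMap, fun _ => rfl, fun f g => ?_⟩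
  exact Subtype.ext (h.hamiltonian_poisson f g)
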